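/- Let $A$ be a locally $C^*$-algebra, that is, a complex (not necessarily unital) $*$-algebra equipped with a Hausdorff, complete locally convex topology that is generated by a family of $C^*$-seminorms, i.e. seminorms $s$ with $s(ab)\le s(a)s(b)$, $s(a^*)=s(a)$ and $s(a^*a)=s(a)^2$. Ideals of $A$ are two-sided linear ideals. A representation of $A$ is a continuous $*$-homomorphism $\pi: A\to\mathcal{B}(\mathcal{H})$ into the bounded operators on a complex Hilbert space $\mathcal H$ (with the operator norm); it is irreducible if it is nonzero and $\{0\}$ and $\mathcal H$ are its only closed invariant subspaces. A primitive ideal of $A$ is an ideal of the form $P=\ker\pi$ with $\pi$ an irreducible representation of $A$. Then: 1. Every closed ideal $I$ of $A$ is the intersection of the primitive ideals of $A$ that contain $I$ (the intersection of the empty family being $A$). 2. Every primitive ideal $P$ of $A$ is prime in the following sense: if $I$ and $J$ are (not necessarily closed) ideals of $A$ with $I\cap J\subset P$, then $I\subset P$ or $J\subset P$. -/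

import Mathlib

universe u

/-- A C*-seminorm on a complex *-algebra. -/
structure IsCStarSeminorm {A : Type u} [NonUnitalRing A] [StarRing A] [Module ℂ A]
    (s : Seminorm ℂ A) : Prop where
  mul_le : ∀ a b : A, s (a * b) ≤ s a * s b
  star_eq : ∀ a : A, s (star a) = s a
  star_mul_self : ∀ a : A, s (star a * a) = s a ^ 2

/-- A locally C*-algebra: a complex, not necessarily unital, *-algebra with a Hausdorff and complete
locally convex topology generated by a family of C*-seminorms. Completeness refers to the uniform
structure of the additive topological group `A`. -/
class LocallyCStarAlgebra (A : Type u) [NonUnitalRing A] [StarRing A] [Module ℂ A]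
    [UniformSpace A] : Prop extends
    IsScalarTower ℂ A A, SMulCommClass ℂ A A, StarModule ℂ A,
    IsUniformAddGroup A, T2Space A, CompleteSpace A where
  exists_cstarSeminorms : ∃ S : Set (Seminorm ℂ A),
    (∀ s ∈ S, IsCStarSeminorm s) ∧ WithSeminorms (fun s : S => (s : Seminorm ℂ A))

/-- A (two-sided, not necessarily closed) ideal of a complex algebra: a linear subspace that is
stable under left and right multiplication by arbitrary elements. -/
structure IsAlgebraIdeal {A : Type u} [NonUnitalRing A] [Module ℂ A] (I : Submodule ℂ A) :
    Prop where
  mul_mem_left : ∀ a x : A, x ∈ I → a * x ∈ I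
  mul_mem_right : ∀ a x : A, x ∈ I → x * a ∈ I

/-- A *-representation `π` on a Hilbert space is (topologically) irreducible if it is nonzero and
its only closed invariant subspaces are `0` and the whole space. -/
structure IsIrreducibleRep {A : Type u} [NonUnitalRing A] [StarRing A] [Module ℂ A]
    {H : Type u} [NormedAddCommGroup H] [InnerProductSpace ℂ H] [CompleteSpace H]
    (π : A →⋆ₙₐ[ℂ] (H →L[ℂ] H)) : Prop where
  ne_zero : ∃ a : A, π a ≠ 0
  eq_bot_or_eq_top : ∀ V : Submodule ℂ H, IsClosed (V : Set H) →
    (∀ (a : A), ∀ v ∈ V, π a v ∈ V) → V = ⊥ ∨ V = ⊤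

/-- The primitive spectrum: the set of all primitive ideals, that is, of all ideals that are kernels
of irreducible representations of `A`. A representation is a *-homomorphism into the bounded
operators of a Hilbert space that is continuous for the operator norm. An irreducible
representation has a dense orbit `π(A)v`, so every one is unitarily equivalent to one on a Hilbert
space in the universe of `A`. -/
def PrimitiveSpectrum (A : Type u) [NonUnitalRing A] [StarRing A] [Module ℂ A]
    [UniformSpace A] : Set (Submodule ℂ A) :=
  {P | IsAlgebraIdeal P ∧ ∃ (H : Type u) (_ : NormedAddCommGroup H) (_ : InnerProductSpace ℂ H)
      (_ : CompleteSpace H) (π : A →⋆ₙₐ[ℂ] (H →L[ℂ] H)),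
      Continuous π ∧ IsIrreducibleRep π ∧ ∀ a : A, a ∈ P ↔ π a = 0}

/-! Part 1 reduces to a C*-algebra. If `I` is closed and `a ∉ I`, some continuous C*-seminorm `s`
keeps `a` at positive distance from `I`. Completing the unitization of `A` modulo the kernel of `s`
gives a unital C*-algebra `U` and `φ : A → U` with `‖φ a‖ = s a`; the closure `J` of `φ(I)` is an
ideal of `U` that misses `φ a`. In `U`, Hahn–Banach separation yields a state that kills `J` but not
`a* a`. This uses that closed ideals are approximately hereditary
(`mem_of_forall_star_mul_self_le`). The states killing `J` form a weak-* compact convex set, so by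
Krein–Milman an extreme one also detects `a`. Its GNS representation is irreducible, and pulling it
back along `φ` gives the primitive ideal. Part 2 is algebraic: if `i ∈ I` and `π i ≠ 0`, then `π i`
annihilates the invariant subspace generated by `π(J)H`, which must therefore be zero. -/

/-! ### Approximate heredity of closed ideals in a C*-algebra. -/

section CStarIdeal

variable {U : Type u} [CStarAlgebra U] [PartialOrder U] [StarOrderedRing U]

/-- In a C*-algebra, `b ↦ a * (1 - ε d⁻¹)` approximates `a` when `star a * a ≤ d` and `ε ≤ d`. -/
theorem norm_mul_inv_sq_le {ε : ℝ} (hε : 0 < ε) {a d : U} (had : star a * a ≤ d)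
    (hεd : algebraMap ℝ U ε ≤ d) :
    ∃ r : U, d * r = 1 ∧ ‖a * (ε • r)‖ ^ 2 ≤ ε := by
  have hpos : IsStrictlyPositive (algebraMap ℝ U ε) := by
    rw [IsStrictlyPositive.iff_of_unital]
    exact ⟨by rw [Algebra.algebraMap_eq_smul_one]; exact smul_nonneg hε.le zero_le_one,
      (IsUnit.mk0 ε hε.ne').map (algebraMap ℝ U)⟩
  obtain ⟨v, rfl⟩ := CStarAlgebra.isUnit_of_le _ hεd hpos
  have hv : 0 ≤ (v : U) := hpos.nonneg.trans hεd
  have hr : 0 ≤ ((v⁻¹ : Uˣ) : U) := CFC.inv_nonneg_of_nonneg v hv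
  set r : U := ((v⁻¹ : Uˣ) : U) with hrdef
  have hsa : star r = r := (IsSelfAdjoint.of_nonneg hr).star_eq
  have hvr : (v : U) * r = 1 := by simp [r]
  -- Conjugating `ε ≤ d` by `r = d⁻¹` gives `ε r² ≤ r`, whence `ε ‖r‖ ≤ 1`.
  have hrle : ε • (r * r) ≤ r := by
    have := star_left_conjugate_le_conjugate hεd r
    rw [hsa, mul_assoc r (v : U) r, hvr, mul_one, Algebra.algebraMap_eq_smul_one,
      mul_smul_comm, mul_one, smul_mul_assoc] at this
    exact this
  have hrr : 0 ≤ r * r := by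
    have := star_mul_self_nonneg r
    rwa [hsa] at this
  have hnorm : ε * ‖r‖ ≤ 1 := by
    have h1 := CStarAlgebra.norm_le_norm_of_nonneg_of_le (smul_nonneg hε.le hrr) hrle
    have h2 : ‖r * r‖ = ‖r‖ * ‖r‖ := by
      have := CStarRing.norm_star_mul_self (x := r)
      rwa [hsa] at this
    rw [norm_smul, Real.norm_of_nonneg hε.le, h2] at h1
    rcases (norm_nonneg r).eq_or_lt with h0 | h0
    · rw [← h0]; simp
    · exact le_of_mul_le_mul_right (by linarith) h0
  refine ⟨r, hvr, ?_⟩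
  have h1 : star r * (star a * a) * r ≤ r := by
    have := star_left_conjugate_le_conjugate had r
    rw [hsa, mul_assoc r (v : U) r, hvr, mul_one] at this
    rwa [hsa]
  have h2 : ‖star r * (star a * a) * r‖ ≤ ‖r‖ :=
    CStarAlgebra.norm_le_norm_of_nonneg_of_le
      (star_left_conjugate_nonneg (star_mul_self_nonneg a) r) h1
  have h3 : ‖a * r‖ ^ 2 ≤ ‖r‖ := by
    rw [sq, ← CStarRing.norm_star_mul_self, star_mul]
    simpa only [mul_assoc] using h2
  rw [mul_smul_comm, norm_smul, Real.norm_of_nonneg hε.le, mul_pow]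
  calc ε ^ 2 * ‖a * r‖ ^ 2 ≤ ε ^ 2 * ‖r‖ := by gcongr
    _ = ε * (ε * ‖r‖) := by ring
    _ ≤ ε * 1 := by gcongr
    _ = ε := mul_one ε

/-- A closed ideal of a C*-algebra is hereditary, in an approximate sense. -/
theorem mem_of_forall_star_mul_self_le {J : Submodule ℂ U} (hJ : IsAlgebraIdeal J)
    (hJc : IsClosed (J : Set U)) {a : U}
    (h : ∀ ε : ℝ, 0 < ε → ∃ j ∈ J, IsSelfAdjoint j ∧ star a * a ≤ j + algebraMap ℝ U ε) :
    a ∈ J := by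
  rw [← SetLike.mem_coe, ← hJc.closure_eq, Metric.mem_closure_iff]
  intro η hη
  set ε : ℝ := η ^ 2 / 2 with hε'
  have hε : 0 < ε := by positivity
  obtain ⟨j, hjJ, hj, haj⟩ := h (ε / 2) (by positivity)
  -- `j` need not be positive, so it is replaced by a positive `c ∈ J`; expanding `(j - ε)² ≥ 0`
  -- gives `j ≤ c + ε/2`.
  set c : U := (1 / (2 * ε)) • (j * j) with hc
  have hjj : 0 ≤ j * j := by
    have := star_mul_self_nonneg j
    rwa [hj.star_eq] at this
  have hc0 : 0 ≤ c := smul_nonneg (by positivity) hjj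
  have hjc : j ≤ c + algebraMap ℝ U (ε / 2) := by
    have hs : star (j - algebraMap ℝ U ε) = j - algebraMap ℝ U ε := by
      rw [star_sub, hj.star_eq, Algebra.algebraMap_eq_smul_one]; simp
    have h0 : 0 ≤ (1 / (2 * ε)) • ((j - algebraMap ℝ U ε) * (j - algebraMap ℝ U ε)) := by
      refine smul_nonneg (by positivity) ?_
      have := star_mul_self_nonneg (j - algebraMap ℝ U ε)
      rwa [hs] at this
    rw [← sub_nonneg]
    convert h0 using 1
    rw [hc]
    simp only [Algebra.algebraMap_eq_smul_one, sub_mul, mul_sub, smul_sub, smul_mul_assoc,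
      mul_smul_comm, one_mul, mul_one, smul_smul]
    have e1 : 1 / (2 * ε) * ε = 1 / 2 := by field_simp
    have e2 : 1 / (2 * ε) * (ε * ε) = ε / 2 := by field_simp
    rw [e1, e2]
    module
  have had : star a * a ≤ c + algebraMap ℝ U ε := by
    refine haj.trans ((add_le_add_left hjc _).trans_eq ?_)
    rw [add_assoc, ← map_add, add_halves]
  obtain ⟨r, hr, hnorm⟩ := norm_mul_inv_sq_le hε had (le_add_of_nonneg_left hc0)
  have hcJ : c ∈ J := by
    rw [hc, ← Complex.coe_smul]
    exact J.smul_mem _ (hJ.mul_mem_left j j hjJ)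
  -- With `r = (c + ε)⁻¹` one has `c r = 1 - ε r`, so the error is `a (ε r)`, of squared norm at
  -- most `ε = η²/2`.
  refine ⟨a * (c * r), hJ.mul_mem_left _ _ (hJ.mul_mem_right _ _ hcJ), ?_⟩
  have e : a - a * (c * r) = a * (ε • r) := by
    have : c * r = 1 - ε • r := by
      rw [← hr, add_mul, Algebra.algebraMap_eq_smul_one, smul_mul_assoc ε, one_mul,
        add_sub_cancel_right]
    rw [this, mul_sub, mul_one, sub_sub_cancel]
  rw [dist_eq_norm, e]
  refine lt_of_pow_lt_pow_left₀ 2 hη.le (hnorm.trans_lt ?_)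
  rw [hε']
  have : 0 < η ^ 2 := by positivity
  linarith

end CStarIdeal

/-! ### Krein–Milman in the weak-* dual. -/

theorem subset_of_extremePoints_subset {E : Type u} [AddCommGroup E] [Module ℝ E]
    [TopologicalSpace E] [T2Space E] [IsTopologicalAddGroup E] [ContinuousSMul ℝ E]
    [LocallyConvexSpace ℝ E] {S T : Set E} (hS : IsCompact S) (hSc : Convex ℝ S)
    (hT : IsClosed T) (hTc : Convex ℝ T) (h : S.extremePoints ℝ ⊆ T) : S ⊆ T := by
  rw [← closure_convexHull_extremePoints hS hSc]
  exact closure_minimal (convexHull_min h hTc) hT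

/-- Evaluation at `x` is weak-* continuous and linear, so its zero set is closed and convex and
Krein–Milman applies. -/
theorem apply_eq_zero_of_forall_mem_extremePoints {E : Type u} [NormedAddCommGroup E]
    [NormedSpace ℂ E] {S : Set (WeakDual ℂ E)} (hS : IsCompact S) (hconv : Convex ℝ S) {x : E}
    (h : ∀ f ∈ S.extremePoints ℝ, f x = 0) {f : WeakDual ℂ E} (hf : f ∈ S) : f x = 0 := by
  have hlc : LocallyConvexSpace ℝ (WeakDual ℂ E) :=
    WeakBilin.locallyConvexSpace (B := topDualPairing ℂ E)
  have hst : IsScalarTower ℝ ℂ (WeakDual ℂ E) :=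
    inferInstanceAs (IsScalarTower ℝ ℂ (E →L[ℂ] ℂ))
  have hcs : ContinuousSMul ℝ (WeakDual ℂ E) := IsScalarTower.continuousSMul ℂ
  have hclosed : IsClosed {g : WeakDual ℂ E | g x = 0} :=
    isClosed_eq (WeakDual.eval_continuous x) continuous_const
  have hconv' : Convex ℝ {g : WeakDual ℂ E | g x = 0} := by
    intro g hg h hh s t _ _ _
    have hg' : g x = 0 := hg
    have hh' : h x = 0 := hh
    change s • g x + t • h x = 0
    rw [hg', hh', smul_zero, smul_zero, add_zero]
  exact @subset_of_extremePoints_subset (WeakDual ℂ E) WeakDual.instAddCommGroup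
    (WeakDual.instModule' ℝ) (instTopologicalSpaceWeakDual ℂ E) WeakDual.instT2Space
    WeakDual.instIsTopologicalAddGroup hcs hlc S _ hS hconv hclosed hconv' h f hf

/-! ### States that vanish on a closed ideal. -/

section IdealStates

open scoped ComplexOrder

variable {U : Type u} [CStarAlgebra U]

/-- The states of a unital C*-algebra that vanish on `star x * x` for every `x ∈ J`. -/
def idealStates (J : Submodule ℂ U) : Set (WeakDual ℂ U) :=
  {f | (∀ x, 0 ≤ f (star x * x)) ∧ f 1 = 1 ∧ ∀ x ∈ J, f (star x * x) = 0}

theorem isClosed_idealStates (J : Submodule ℂ U) : IsClosed (idealStates J) := by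
  have hc : ∀ x : U, Continuous fun f : WeakDual ℂ U => f x := WeakDual.eval_continuous
  simp only [idealStates, Set.ofPred_and, Set.ofPred_forall]
  refine (isClosed_iInter fun x => isClosed_le continuous_const (hc _)).inter
    ((isClosed_eq (hc _) continuous_const).inter
      (isClosed_iInter fun x => isClosed_iInter fun _ => isClosed_eq (hc _) continuous_const))

theorem convex_idealStates (J : Submodule ℂ U) : Convex ℝ (idealStates J) := by
  rintro f ⟨hf, hf1, hfJ⟩ g ⟨hg, hg1, hgJ⟩ s t hs ht hst
  have happ : ∀ x, (s • f + t • g : WeakDual ℂ U) x = s * f x + t * g x := fun x => by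
    change s • f x + t • g x = _
    simp
  refine ⟨fun x => ?_, ?_, fun x hx => ?_⟩
  · rw [happ]
    exact add_nonneg (mul_nonneg (by exact_mod_cast hs) (hf x))
      (mul_nonneg (by exact_mod_cast ht) (hg x))
  · rw [happ, hf1, hg1, mul_one, mul_one]
    exact_mod_cast hst
  · rw [happ, hfJ x hx, hgJ x hx, mul_zero, mul_zero, add_zero]

variable [PartialOrder U] [StarOrderedRing U]

/-- The convex cone of elements whose real part is nonnegative modulo `J`. -/
def realPartNonnegModulo (J : Submodule ℂ U) : Set U :=
  {x | ∃ j ∈ J, IsSelfAdjoint j ∧ 0 ≤ x + star x + j}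

theorem smul_mem_realPartNonnegModulo {J : Submodule ℂ U} {x : U}
    (hx : x ∈ realPartNonnegModulo J) {t : ℝ} (ht : 0 ≤ t) : t • x ∈ realPartNonnegModulo J := by
  obtain ⟨j, hjJ, hj, h⟩ := hx
  refine ⟨t • j, by rw [← Complex.coe_smul]; exact J.smul_mem _ hjJ, .smul (.all t) hj, ?_⟩
  rw [star_smul, star_trivial, ← smul_add, ← smul_add]
  exact smul_nonneg ht h

theorem add_mem_realPartNonnegModulo {J : Submodule ℂ U} {x y : U}
    (hx : x ∈ realPartNonnegModulo J) (hy : y ∈ realPartNonnegModulo J) :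
    x + y ∈ realPartNonnegModulo J := by
  obtain ⟨j, hjJ, hj, h⟩ := hx
  obtain ⟨k, hkJ, hk, h'⟩ := hy
  refine ⟨j + k, J.add_mem hjJ hkJ, hj.add hk, ?_⟩
  convert add_nonneg h h' using 1
  rw [star_add]
  abel

theorem convex_realPartNonnegModulo (J : Submodule ℂ U) :
    Convex ℝ (realPartNonnegModulo J) := fun _ hx _ hy _ _ hs ht _ =>
  add_mem_realPartNonnegModulo (smul_mem_realPartNonnegModulo hx hs)
    (smul_mem_realPartNonnegModulo hy ht)

/-- If `x` in the cone is within `ε` of `-a* a`, put `h = x + a* a`. Positivity of `x + x* + j` then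
reads `2 a* a ≤ j + h + h* ≤ j + 2ε`, and approximate heredity puts `a` in `J`. -/
theorem neg_star_mul_self_notMem_closure {J : Submodule ℂ U} (hJ : IsAlgebraIdeal J)
    (hJc : IsClosed (J : Set U)) {a : U} (ha : a ∉ J) :
    -(star a * a) ∉ closure (realPartNonnegModulo J) := by
  intro hmem
  refine ha (mem_of_forall_star_mul_self_le hJ hJc fun ε hε => ?_)
  obtain ⟨x, ⟨j, hjJ, hj, hx⟩, hdist⟩ := Metric.mem_closure_iff.1 hmem ε hε
  set h : U := x + star a * a with hh
  have hnorm : ‖h‖ < ε := by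
    rw [dist_eq_norm] at hdist
    rwa [hh, ← norm_neg, neg_add, add_comm, ← sub_eq_add_neg]
  have hhsa : IsSelfAdjoint (h + star h) := IsSelfAdjoint.add_star_self h
  have hle : h + star h ≤ algebraMap ℝ U (2 * ε) := by
    refine hhsa.le_algebraMap_norm_self.trans (algebraMap_mono U ?_)
    calc ‖h + star h‖ ≤ ‖h‖ + ‖star h‖ := norm_add_le _ _
      _ ≤ 2 * ε := by rw [norm_star]; linarith
  refine ⟨(1 / 2 : ℝ) • j, by rw [← Complex.coe_smul]; exact J.smul_mem _ hjJ,
    .smul (.all _) hj, ?_⟩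
  have h2 : 0 ≤ (1 / 2 : ℝ) • ((x + star x + j) + (algebraMap ℝ U (2 * ε) - (h + star h))) :=
    smul_nonneg (by norm_num) (add_nonneg hx (sub_nonneg.2 hle))
  rw [← sub_nonneg]
  convert h2 using 1
  rw [hh]
  simp only [star_add, star_mul, star_star, Algebra.algebraMap_eq_smul_one]
  module

/-- A functional separating `-a* a` from the closed cone has nonnegative real part on the cone. The
cone contains the positive elements, `i k` for self-adjoint `k`, and the self-adjoint part of `J`;
hence the functional is positive and kills the self-adjoint part of `J`. Dividing by its value at
`1` gives a state. -/
theorem exists_mem_idealStates_ne_zero {J : Submodule ℂ U} (hJ : IsAlgebraIdeal J)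
    (hJc : IsClosed (J : Set U)) {a : U} (ha : a ∉ J) :
    ∃ f ∈ idealStates J, f (star a * a) ≠ 0 := by
  obtain ⟨f, u, hfa, hf⟩ := RCLike.geometric_hahn_banach_point_closed (𝕜 := ℂ)
    (convex_realPartNonnegModulo J).closure isClosed_closure
    (neg_star_mul_self_notMem_closure hJ hJc ha)
  simp only [RCLike.re_eq_complex_re] at hfa hf
  have hsmul : ∀ (t : ℝ) (x : U), f (t • x) = t * f x := fun t x => by
    rw [← Complex.coe_smul, map_smul, smul_eq_mul]
  have h0 : (0 : U) ∈ realPartNonnegModulo J := ⟨0, J.zero_mem, .zero U, by simp⟩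
  have hu : u < 0 := by simpa using hf 0 (subset_closure h0)
  have hnonneg : ∀ x ∈ realPartNonnegModulo J, 0 ≤ (f x).re := by
    intro x hx
    by_contra! hneg
    -- The scaling makes the real part exactly `u`, against the strict bound `u < Re f`.
    have := hf _ (subset_closure
      (smul_mem_realPartNonnegModulo hx (t := u / (f x).re) (div_nonneg_of_nonpos hu.le hneg.le)))
    rw [hsmul, Complex.re_ofReal_mul, div_mul_cancel₀ _ hneg.ne] at this
    exact lt_irrefl _ this
  have him : ∀ k : U, IsSelfAdjoint k → (f k).im = 0 := by
    have key : ∀ k : U, IsSelfAdjoint k → (f k).im ≤ 0 := fun k hk => by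
      have := hnonneg (Complex.I • k) ⟨0, J.zero_mem, .zero U, by simp [hk.star_eq]⟩
      simpa using this
    intro k hk
    have h2 := key (-k) hk.neg
    rw [map_neg, Complex.neg_im] at h2
    exact le_antisymm (key k hk) (by linarith)
  have hpos : ∀ p : U, 0 ≤ p → 0 ≤ f p := fun p hp => by
    have hsa := IsSelfAdjoint.of_nonneg hp
    rw [Complex.nonneg_iff]
    exact ⟨hnonneg p ⟨0, J.zero_mem, .zero U, by
      rw [hsa.star_eq, add_zero]; exact add_nonneg hp hp⟩, (him p hsa).symm⟩
  have hideal : ∀ j ∈ J, IsSelfAdjoint j → f j = 0 := fun j hjJ hj => by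
    have hmem : ∀ k ∈ J, IsSelfAdjoint k → 0 ≤ (f k).re := fun k hkJ hk =>
      hnonneg k ⟨-(k + k), J.neg_mem (J.add_mem hkJ hkJ), (hk.add hk).neg, by
        rw [hk.star_eq, add_neg_cancel]⟩
    have h2 := hmem (-j) (J.neg_mem hjJ) hj.neg
    rw [map_neg, Complex.neg_re] at h2
    exact Complex.ext (le_antisymm (by simpa using h2) (hmem j hjJ hj)) (him j hj)
  have hfa' : 0 < (f (star a * a)).re := by
    rw [map_neg, Complex.neg_re] at hfa
    linarith
  have hf1 : 0 < f 1 := by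
    refine lt_of_le_of_ne (hpos 1 zero_le_one) fun h1 => ?_
    -- Since `a* a ≤ ‖a‖²`, `f 1 = 0` would force `f (a* a) ≤ 0`.
    have h3 := hpos _ (sub_nonneg.2 (CStarAlgebra.star_mul_le_algebraMap_norm_sq (a := a)))
    rw [map_sub, Algebra.algebraMap_eq_smul_one, hsmul, ← h1, mul_zero, zero_sub,
      Complex.nonneg_iff, Complex.neg_re] at h3
    linarith [h3.1]
  refine ⟨StrongDual.toWeakDual ((f 1)⁻¹ • f), ⟨fun x => ?_, ?_, fun x hx => ?_⟩, ?_⟩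
  · exact mul_nonneg (inv_nonneg.2 hf1.le) (hpos _ (star_mul_self_nonneg x))
  · exact inv_mul_cancel₀ hf1.ne'
  · change (f 1)⁻¹ * f (star x * x) = 0
    rw [hideal _ (hJ.mul_mem_left _ _ hx) (.star_mul_self x), mul_zero]
  · refine mul_ne_zero (inv_ne_zero hf1.ne') fun h => ?_
    change f (star a * a) = 0 at h
    rw [h] at hfa'
    exact lt_irrefl _ hfa'

/-- A functional that is nonnegative on all `star x * x`, as a positive linear map. -/
def positiveLinearMapOfStarMulSelf (f : U →ₗ[ℂ] ℂ) (hf : ∀ x, 0 ≤ f (star x * x)) :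
    U →ₚ[ℂ] ℂ where
  toLinearMap := f
  monotone' x y hxy := by
    obtain ⟨z, hz⟩ := CStarAlgebra.nonneg_iff_eq_star_mul_self.1 (sub_nonneg.2 hxy)
    have := hf z
    rw [← hz, map_sub] at this
    exact sub_nonneg.1 this

/-- Cauchy–Schwarz in the pre-GNS space, where `f x = ⟪1, x·1⟫` and `‖1‖ = 1`. This bound makes
Banach–Alaoglu applicable. -/
theorem norm_apply_le_of_mem_idealStates {J : Submodule ℂ U} {f : WeakDual ℂ U}
    (hf : f ∈ idealStates J) (x : U) : ‖f x‖ ≤ ‖x‖ := by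
  set F := positiveLinearMapOfStarMulSelf (f : U →ₗ[ℂ] ℂ) hf.1 with hF
  have happ : ∀ y, F y = f y := fun _ => rfl
  have h1 : ‖F.toPreGNS 1‖ = 1 := by
    rw [F.preGNS_norm_def]
    simp [happ, hf.2.1]
  have h2 : inner ℂ (F.toPreGNS 1) (F.leftMulMapPreGNS x (F.toPreGNS 1)) = f x := by
    rw [F.preGNS_inner_def]
    simp [happ]
  have h3 : ‖F.leftMulMapPreGNS x (F.toPreGNS 1)‖ ≤ ‖x‖ * ‖F.toPreGNS 1‖ :=
    (F.leftMulMapPreGNS x).le_of_opNorm_le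
      (LinearMap.mkContinuous_norm_le _ (norm_nonneg x) _) _
  rw [← h2]
  refine (norm_inner_le_norm _ _).trans ?_
  rw [h1, mul_one] at *
  linarith

theorem isCompact_idealStates (J : Submodule ℂ U) : IsCompact (idealStates J) := by
  refine (WeakDual.isCompact_closedBall (𝕜 := ℂ) (E := U) 0 1).of_isClosed_subset
    (isClosed_idealStates J) fun f hf => ?_
  simp only [Set.mem_preimage, mem_closedBall_zero_iff]
  refine ContinuousLinearMap.opNorm_le_bound _ zero_le_one fun x => ?_
  rw [one_mul]
  exact norm_apply_le_of_mem_idealStates hf x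

theorem exists_mem_extremePoints_idealStates {J : Submodule ℂ U} (hJ : IsAlgebraIdeal J)
    (hJc : IsClosed (J : Set U)) {a : U} (ha : a ∉ J) :
    ∃ f ∈ Set.extremePoints ℝ (idealStates J), f (star a * a) ≠ 0 := by
  by_contra! hall
  obtain ⟨f, hf, hfa⟩ := exists_mem_idealStates_ne_zero hJ hJc ha
  exact hfa (apply_eq_zero_of_forall_mem_extremePoints (isCompact_idealStates J)
    (convex_idealStates J) hall hf)

end IdealStates

/-! ### Irreducible GNS representations from extreme states. -/

section IrreducibleGNS

open scoped ComplexOrder InnerProductSpace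

variable {U : Type u} [CStarAlgebra U]

section VectorState

variable {H : Type u} [NormedAddCommGroup H] [InnerProductSpace ℂ H] [CompleteSpace H]

/-- The normalized functional `x ↦ ⟪v, π x v⟫ / ‖v‖ ^ 2`. -/
noncomputable def vectorState (π : U →⋆ₐ[ℂ] (H →L[ℂ] H)) (v : H) : WeakDual ℂ U :=
  StrongDual.toWeakDual <| LinearMap.mkContinuous
    { toFun := fun x => ((‖v‖ : ℂ) ^ 2)⁻¹ * ⟪v, π x v⟫_ℂ
      map_add' := fun x y => by
        rw [map_add, add_apply, inner_add_right, mul_add]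
      map_smul' := fun c x => by
        rw [map_smul, smul_apply, inner_smul_right, RingHom.id_apply,
          smul_eq_mul]
        ring }
    1 fun x => by
      change ‖((‖v‖ : ℂ) ^ 2)⁻¹ * ⟪v, π x v⟫_ℂ‖ ≤ 1 * ‖x‖
      -- For `v = 0` the convention `0⁻¹ = 0` gives the zero functional.
      rcases eq_or_ne v 0 with rfl | hv
      · simp
      have h1 : ‖π x v‖ ≤ ‖x‖ * ‖v‖ :=
        (π x).le_of_opNorm_le (NonUnitalStarAlgHom.norm_apply_le π x) v
      have h2 : ‖⟪v, π x v⟫_ℂ‖ ≤ ‖v‖ ^ 2 * ‖x‖ := by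
        refine (norm_inner_le_norm _ _).trans ?_
        calc ‖v‖ * ‖π x v‖ ≤ ‖v‖ * (‖x‖ * ‖v‖) := by gcongr
          _ = _ := by ring
      rw [norm_mul, norm_inv, norm_pow, Complex.norm_real, norm_norm, one_mul]
      have hv' : 0 < ‖v‖ ^ 2 := by positivity
      rwa [inv_mul_le_iff₀ hv']

theorem vectorState_apply (π : U →⋆ₐ[ℂ] (H →L[ℂ] H)) (v : H) (x : U) :
    vectorState π v x = ((‖v‖ : ℂ) ^ 2)⁻¹ * ⟪v, π x v⟫_ℂ := rfl

theorem inner_map_star_mul_self (π : U →⋆ₐ[ℂ] (H →L[ℂ] H)) (v : H) (x : U) :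
    ⟪v, π (star x * x) v⟫_ℂ = (‖π x v‖ : ℂ) ^ 2 := by
  rw [map_mul, map_star, mul_apply_eq_comp, ContinuousLinearMap.star_eq_adjoint,
    ContinuousLinearMap.adjoint_inner_right, inner_self_eq_norm_sq_to_K]
  rfl

theorem vectorState_mem_idealStates {J : Submodule ℂ U} (π : U →⋆ₐ[ℂ] (H →L[ℂ] H))
    (hπ : ∀ x ∈ J, π x = 0) {v : H} (hv : v ≠ 0) : vectorState π v ∈ idealStates J := by
  have hv' : ((‖v‖ : ℂ) ^ 2) ≠ 0 := by simpa using hv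
  refine ⟨fun x => ?_, ?_, fun x hx => ?_⟩
  · rw [vectorState_apply, inner_map_star_mul_self]
    norm_cast
    positivity
  · rw [vectorState_apply, map_one, one_apply_eq_self, inner_self_eq_norm_sq_to_K]
    exact inv_mul_cancel₀ hv'
  · rw [vectorState_apply, inner_map_star_mul_self, hπ x hx]
    simp

theorem map_mem_orthogonal (π : U →⋆ₐ[ℂ] (H →L[ℂ] H)) {V : Submodule ℂ H}
    (hV : ∀ x, ∀ v ∈ V, π x v ∈ V) (x : U) {w : H} (hw : w ∈ Vᗮ) : π x w ∈ Vᗮ := by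
  intro v hv
  rw [← ContinuousLinearMap.adjoint_inner_left, ← ContinuousLinearMap.star_eq_adjoint, ← map_star]
  exact hw _ (hV _ v hv)

/-- A representation with a cyclic vector whose vector state is extreme is irreducible. -/
theorem eq_bot_or_eq_top_of_vectorState_mem_extremePoints {J : Submodule ℂ U}
    (π : U →⋆ₐ[ℂ] (H →L[ℂ] H)) (hπ : ∀ x ∈ J, π x = 0) {v : H} (hv : ‖v‖ = 1)
    (hcyc : DenseRange fun x => π x v)
    (hext : vectorState π v ∈ Set.extremePoints ℝ (idealStates J))
    {V : Submodule ℂ H} (hVc : IsClosed (V : Set H)) (hV : ∀ x, ∀ w ∈ V, π x w ∈ V) :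
    V = ⊥ ∨ V = ⊤ := by
  have htop : ∀ W : Submodule ℂ H, IsClosed (W : Set H) → (∀ x, ∀ w ∈ W, π x w ∈ W) → v ∈ W →
      W = ⊤ := by
    intro W hWc hW hvW
    rw [← SetLike.coe_set_eq, ← hWc.closure_eq]
    exact (hcyc.mono (Set.range_subset_iff.2 fun x => hW x v hvW)).closure_eq
  have : CompleteSpace V := hVc.completeSpace_coe
  -- Split the cyclic vector along `V` and `Vᗮ`, both invariant. If `p = 0` then `Vᗮ` contains `v`
  -- and is everything; if `q = 0` then `V` does.
  obtain ⟨p, hp, q, hq, hpq⟩ := V.exists_add_mem_mem_orthogonal v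
  rcases eq_or_ne p 0 with rfl | hp0
  · left
    rw [zero_add] at hpq
    rw [← Submodule.orthogonal_eq_top_iff]
    exact htop _ V.isClosed_orthogonal (fun x w hw => map_mem_orthogonal π hV x hw) (hpq ▸ hq)
  right
  refine htop V hVc hV ?_
  rcases eq_or_ne q 0 with rfl | hq0
  · rw [hpq, add_zero]
    exact hp
  have hsum : ‖p‖ ^ 2 + ‖q‖ ^ 2 = 1 := by
    have := norm_add_sq_eq_norm_sq_add_norm_sq_of_inner_eq_zero p q (𝕜 := ℂ)
      (Submodule.inner_right_of_mem_orthogonal hp hq)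
    rw [← hpq, hv] at this
    nlinarith
  have hpp : ∀ x, ⟪p, π x p⟫_ℂ = ⟪p, π x v⟫_ℂ := fun x => by
    rw [hpq, map_add, inner_add_right,
      Submodule.inner_right_of_mem_orthogonal hp (map_mem_orthogonal π hV x hq), add_zero]
  have hqq : ∀ x, ⟪q, π x q⟫_ℂ = ⟪q, π x v⟫_ℂ := fun x => by
    rw [hpq, map_add, inner_add_right,
      Submodule.inner_left_of_mem_orthogonal (hV x p hp) hq, zero_add]
  have hp2 : ((‖p‖ : ℂ) ^ 2) ≠ 0 := by simpa using hp0
  have hq2 : ((‖q‖ : ℂ) ^ 2) ≠ 0 := by simpa using hq0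
  -- Otherwise the state of `v` is the mixture of those of `p` and `q` with weights `‖p‖²` and
  -- `‖q‖²`, so extremality identifies the states of `p` and `v`.
  have hseg : vectorState π v ∈ openSegment ℝ (vectorState π p) (vectorState π q) := by
    refine ⟨‖p‖ ^ 2, ‖q‖ ^ 2, by positivity, by positivity, hsum, ?_⟩
    refine DFunLike.ext _ _ fun x => ?_
    change (‖p‖ ^ 2 : ℝ) • vectorState π p x + (‖q‖ ^ 2 : ℝ) • vectorState π q x = _
    rw [Complex.real_smul, Complex.real_smul, vectorState_apply, vectorState_apply,
      vectorState_apply, hpp, hqq]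
    push_cast
    rw [mul_inv_cancel_left₀ hp2, mul_inv_cancel_left₀ hq2, ← inner_add_left, ← hpq, hv]
    simp
  have heq := hext.2 (vectorState_mem_idealStates π hπ hp0)
    (vectorState_mem_idealStates π hπ hq0) hseg
  -- Equality of these states makes `p - ‖p‖² v` orthogonal to the dense orbit of `v`; hence `p =
  -- ‖p‖² v` and `v ∈ V`.
  have horth : ∀ x, ⟪p - ((‖p‖ : ℂ) ^ 2) • v, π x v⟫_ℂ = 0 := fun x => by
    have h := DFunLike.congr_fun heq x
    rw [vectorState_apply, vectorState_apply, hpp, hv] at h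
    have h' : ⟪p, π x v⟫_ℂ = (‖p‖ : ℂ) ^ 2 * ⟪v, π x v⟫_ℂ := by
      rw [inv_mul_eq_iff_eq_mul₀ hp2] at h
      simpa using h
    rw [inner_sub_left, inner_smul_left, h', map_pow, Complex.conj_ofReal, sub_self]
  have hzero : p - ((‖p‖ : ℂ) ^ 2) • v = 0 := hcyc.eq_zero_of_inner_left ℂ horth
  rw [← V.smul_mem_iff hp2, ← sub_eq_zero.1 hzero]
  exact hp

end VectorState

variable [PartialOrder U] [StarOrderedRing U]

theorem exists_irreducible_representation_of_notMem {J : Submodule ℂ U} (hJ : IsAlgebraIdeal J)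
    (hJc : IsClosed (J : Set U)) {a : U} (ha : a ∉ J) :
    ∃ (H : Type u) (_ : NormedAddCommGroup H) (_ : InnerProductSpace ℂ H)
      (_ : CompleteSpace H) (π : U →⋆ₐ[ℂ] (H →L[ℂ] H)),
      (∀ x ∈ J, π x = 0) ∧ π a ≠ 0 ∧ ∀ V : Submodule ℂ H, IsClosed (V : Set H) →
        (∀ x, ∀ v ∈ V, π x v ∈ V) → V = ⊥ ∨ V = ⊤ := by
  obtain ⟨f, hf, hfa⟩ := exists_mem_extremePoints_idealStates hJ hJc ha
  set F := positiveLinearMapOfStarMulSelf (f : U →ₗ[ℂ] ℂ) hf.1.1 with hF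
  have happ : ∀ y, F y = f y := fun _ => rfl
  have hcoe : ∀ (x : U) (b : F.PreGNS), F.gnsStarAlgHom x (b : F.GNS) =
      ((F.toPreGNS (x * F.ofPreGNS b) : F.PreGNS) : F.GNS) := fun x b =>
    F.gnsNonUnitalStarAlgHom_apply_coe
  have hnorm : ∀ x : U, ((‖((F.toPreGNS x : F.PreGNS) : F.GNS)‖ : ℂ) ^ 2) = f (star x * x) :=
    fun x => by
      rw [UniformSpace.Completion.norm_coe, F.preGNS_norm_sq, happ, F.ofPreGNS_toPreGNS]
  set v : F.GNS := ((F.toPreGNS 1 : F.PreGNS) : F.GNS) with hv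
  have hpiv : ∀ x, F.gnsStarAlgHom x v = ((F.toPreGNS x : F.PreGNS) : F.GNS) := fun x => by
    rw [hv, hcoe, F.ofPreGNS_toPreGNS, mul_one]
  have hv1 : ‖v‖ = 1 := by
    have := hnorm 1
    rw [star_one, one_mul, hf.1.2.1, ← hv] at this
    norm_cast at this
    exact (pow_eq_one_iff_of_nonneg (norm_nonneg _) two_ne_zero).1 this
  have hkill : ∀ x ∈ J, F.gnsStarAlgHom x = 0 := by
    intro x hx
    ext w
    induction w using UniformSpace.Completion.induction_on with
    | hp => exact isClosed_eq (F.gnsStarAlgHom x).continuous continuous_const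
    | ih b =>
      -- `J` is stable under right multiplication, so `x b ∈ J` and the class of `x b` has norm
      -- zero.
      have h := hnorm (x * F.ofPreGNS b)
      rw [hf.1.2.2 _ (hJ.mul_mem_right _ _ hx)] at h
      rw [hcoe]
      refine norm_eq_zero.1 ?_
      simpa using h
  have hstate : vectorState F.gnsStarAlgHom v = f := by
    refine DFunLike.ext _ _ fun x => ?_
    rw [vectorState_apply, hpiv, hv1, hv, UniformSpace.Completion.inner_coe, F.preGNS_inner_def,
      F.ofPreGNS_toPreGNS, F.ofPreGNS_toPreGNS, happ]
    simp
  refine ⟨F.GNS, inferInstance, inferInstance, inferInstance, F.gnsStarAlgHom, hkill, ?_, ?_⟩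
  · intro h0
    have h := hnorm a
    rw [← hpiv, h0] at h
    exact hfa (by simpa using h.symm)
  · intro V hVc hV
    refine eq_bot_or_eq_top_of_vectorState_mem_extremePoints F.gnsStarAlgHom hkill hv1 ?_
      (by rwa [hstate]) hVc hV
    simp only [hpiv]
    exact (UniformSpace.Completion.denseRange_coe (α := F.PreGNS)).comp
      F.toPreGNS.surjective.denseRange (UniformSpace.Completion.continuous_coe _)

end IrreducibleGNS

/-! ### The C*-algebra of a C*-seminorm: separation quotient, unitization, completion. -/

section SeparationQuotientStar

variable {X : Type u} [NonUnitalSeminormedRing X] [StarRing X] [NormedStarGroup X]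

/-- The involution induced on the separation quotient. -/
noncomputable instance SeparationQuotient.instStarRing : StarRing (SeparationQuotient X) where
  star := SeparationQuotient.lift (fun x : X => SeparationQuotient.mk (star x))
    fun _ _ h => SeparationQuotient.mk_eq_mk.2 (h.map continuous_star)
  star_involutive := by
    rintro ⟨x⟩
    exact congrArg SeparationQuotient.mk (star_star x)
  star_mul := by
    rintro ⟨x⟩ ⟨y⟩
    exact congrArg SeparationQuotient.mk (star_mul x y)
  star_add := by
    rintro ⟨x⟩ ⟨y⟩
    exact congrArg SeparationQuotient.mk (star_add x y)

theorem SeparationQuotient.mk_star (x : X) :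
    SeparationQuotient.mk (star x) = star (SeparationQuotient.mk x) := rfl

instance SeparationQuotient.instStarModule [NormedSpace ℂ X] [StarModule ℂ X] :
    StarModule ℂ (SeparationQuotient X) where
  star_smul c := by
    rintro ⟨x⟩
    exact congrArg SeparationQuotient.mk (star_smul c x)

theorem SeparationQuotient.cstarRing (h : ∀ x : X, ‖x‖ * ‖x‖ ≤ ‖star x * x‖) :
    CStarRing (SeparationQuotient X) where
  norm_mul_self_le := by
    rintro ⟨x⟩
    exact h x

end SeparationQuotientStar

section CompletionCStar

variable {X : Type u} [NormedRing X] [StarRing X]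

open UniformSpace

/-- The involution of the completion of a pre-C*-algebra. -/
noncomputable instance UniformSpace.Completion.instStar : Star (Completion X) where
  star := Completion.map star

theorem UniformSpace.Completion.continuous_star' :
    Continuous (star : Completion X → Completion X) :=
  Completion.continuous_map

variable [CStarRing X]

theorem UniformSpace.Completion.coe_star (x : X) :
    ((star x : X) : Completion X) = star (x : Completion X) :=
  (Completion.map_coe (star_isometry (E := X)).uniformContinuous x).symm

noncomputable instance UniformSpace.Completion.instStarRing : StarRing (Completion X) where
  star_involutive x := by
    induction x using Completion.induction_on with
    | hp =>
      exact isClosed_eq (Completion.continuous_star'.comp Completion.continuous_star')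
        continuous_id
    | ih x => rw [← Completion.coe_star, ← Completion.coe_star, star_star]
  star_mul x y := by
    induction x, y using Completion.induction_on₂ with
    | hp =>
      exact isClosed_eq (Completion.continuous_star'.comp (continuous_fst.mul continuous_snd))
        ((Completion.continuous_star'.comp continuous_snd).mul
          (Completion.continuous_star'.comp continuous_fst))
    | ih x y => simp only [← Completion.coe_mul, ← Completion.coe_star, star_mul]
  star_add x y := by
    induction x, y using Completion.induction_on₂ with
    | hp =>
      exact isClosed_eq (Completion.continuous_star'.comp (continuous_fst.add continuous_snd))
        ((Completion.continuous_star'.comp continuous_fst).add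
          (Completion.continuous_star'.comp continuous_snd))
    | ih x y => simp only [← Completion.coe_add, ← Completion.coe_star, star_add]

instance UniformSpace.Completion.instCStarRing : CStarRing (Completion X) where
  norm_mul_self_le x := by
    induction x using Completion.induction_on with
    | hp =>
      exact isClosed_le (continuous_norm.mul continuous_norm)
        (continuous_norm.comp (Completion.continuous_star'.mul continuous_id))
    | ih x =>
      rw [← Completion.coe_star, ← Completion.coe_mul, Completion.norm_coe, Completion.norm_coe,
        CStarRing.norm_star_mul_self]

variable [NormedAlgebra ℂ X] [StarModule ℂ X]

instance UniformSpace.Completion.instStarModule : StarModule ℂ (Completion X) where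
  star_smul c x := by
    induction x using Completion.induction_on with
    | hp =>
      exact isClosed_eq (Completion.continuous_star'.comp (continuous_const_smul c))
        (Completion.continuous_star'.const_smul (star c))
    | ih x => simp only [← Completion.coe_smul, ← Completion.coe_star, star_smul]

/-- The completion of a unital pre-C*-algebra is a C*-algebra. -/
noncomputable instance UniformSpace.Completion.instCStarAlgebra :
    CStarAlgebra (Completion X) where
  norm_smul_le := norm_smul_le

end CompletionCStar

section CStarSeminorm

open UniformSpace

/-- The embedding of a unital pre-C*-algebra into its completion as a *-homomorphism. -/
noncomputable def UniformSpace.Completion.coeStarHom (X : Type u) [NormedRing X] [StarRing X]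
    [CStarRing X] [NormedAlgebra ℂ X] [StarModule ℂ X] : X →⋆ₐ[ℂ] Completion X where
  toFun := fun x => (x : Completion X)
  map_one' := Completion.coe_one X
  map_zero' := Completion.coe_zero
  map_add' := Completion.coe_add
  map_mul' := Completion.coe_mul
  commutes' _ := rfl
  map_star' := Completion.coe_star

theorem exists_isometric_unitalStarHom_cstarAlgebra (X : Type u) [NormedRing X] [StarRing X]
    [CStarRing X] [NormedAlgebra ℂ X] [StarModule ℂ X] :
    ∃ (U : Type u) (_ : CStarAlgebra U) (ψ : X →⋆ₐ[ℂ] U), (∀ x, ‖ψ x‖ = ‖x‖) ∧ DenseRange ψ :=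
  ⟨Completion X, inferInstance, Completion.coeStarHom X, Completion.norm_coe,
    Completion.denseRange_coe⟩

/-- A pre-C*-algebra embeds isometrically into a unital C*-algebra, in such a way that its image
and the unit span a dense subspace. -/
theorem exists_isometric_starHom_cstarAlgebra (E : Type u) [NonUnitalNormedRing E] [StarRing E]
    [CStarRing E] [NormedSpace ℂ E] [IsScalarTower ℂ E E] [SMulCommClass ℂ E E]
    [StarModule ℂ E] :
    ∃ (U : Type u) (_ : CStarAlgebra U) (φ : E →⋆ₙₐ[ℂ] U), (∀ a, ‖φ a‖ = ‖a‖) ∧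
      DenseRange fun p : ℂ × E => p.1 • (1 : U) + φ p.2 := by
  obtain ⟨U, hU, ψ, hψ, hd⟩ := exists_isometric_unitalStarHom_cstarAlgebra (Unitization ℂ E)
  refine ⟨U, hU, (ψ : Unitization ℂ E →⋆ₙₐ[ℂ] U).comp (Unitization.inrNonUnitalStarAlgHom ℂ E),
    fun a => (hψ _).trans (Unitization.norm_inr a), hd.mono ?_⟩
  rintro _ ⟨x, rfl⟩
  refine ⟨(x.fst, x.snd), ?_⟩
  change x.fst • (1 : U) + ψ (x.snd : Unitization ℂ E) = ψ x
  rw [← map_one ψ, ← map_smul, ← map_add]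
  congr 1
  ext <;> simp

/-- The quotient map onto the separation quotient as a *-homomorphism. -/
noncomputable def SeparationQuotient.mkStarHom (X : Type u) [NonUnitalSeminormedRing X]
    [StarRing X] [NormedStarGroup X] [NormedSpace ℂ X] : X →⋆ₙₐ[ℂ] SeparationQuotient X where
  toFun := SeparationQuotient.mk
  map_smul' _ _ := rfl
  map_zero' := rfl
  map_add' _ _ := rfl
  map_mul' _ _ := rfl
  map_star' _ := rfl

theorem exists_normPreserving_starHom_cstarAlgebra (X : Type u) [NonUnitalSeminormedRing X]
    [StarRing X] [NormedStarGroup X] [NormedSpace ℂ X] [IsScalarTower ℂ X X]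
    [SMulCommClass ℂ X X] [StarModule ℂ X] (h : ∀ x : X, ‖x‖ * ‖x‖ ≤ ‖star x * x‖) :
    ∃ (U : Type u) (_ : CStarAlgebra U) (φ : X →⋆ₙₐ[ℂ] U), (∀ a, ‖φ a‖ = ‖a‖) ∧
      DenseRange fun p : ℂ × X => p.1 • (1 : U) + φ p.2 := by
  have : CStarRing (SeparationQuotient X) := SeparationQuotient.cstarRing h
  have : IsScalarTower ℂ (SeparationQuotient X) (SeparationQuotient X) := ⟨by
    rintro c ⟨x⟩ ⟨y⟩
    exact congrArg SeparationQuotient.mk (smul_mul_assoc c x y)⟩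
  have : SMulCommClass ℂ (SeparationQuotient X) (SeparationQuotient X) := ⟨by
    rintro c ⟨x⟩ ⟨y⟩
    exact congrArg SeparationQuotient.mk (mul_smul_comm c x y).symm⟩
  obtain ⟨U, hU, φ, hφ, hd⟩ := exists_isometric_starHom_cstarAlgebra (SeparationQuotient X)
  refine ⟨U, hU, φ.comp (SeparationQuotient.mkStarHom X), fun a => hφ _, hd.mono ?_⟩
  rintro _ ⟨⟨c, ⟨x⟩⟩, rfl⟩
  exact ⟨(c, x), rfl⟩

/-- Every C*-seminorm is the pullback of the norm of a unital C*-algebra along a *-homomorphism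
whose range and the unit span a dense subspace. -/
theorem IsCStarSeminorm.exists_cstarAlgebra {A : Type u} [NonUnitalRing A] [StarRing A]
    [Module ℂ A] [IsScalarTower ℂ A A] [SMulCommClass ℂ A A] [StarModule ℂ A]
    {s : Seminorm ℂ A} (hs : IsCStarSeminorm s) :
    ∃ (U : Type u) (_ : CStarAlgebra U) (φ : A →⋆ₙₐ[ℂ] U), (∀ a, ‖φ a‖ = s a) ∧
      DenseRange fun p : ℂ × A => p.1 • (1 : U) + φ p.2 := by
  let _ : SeminormedAddCommGroup A := s.toAddGroupSeminorm.toSeminormedAddCommGroup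
  let _ : NonUnitalSeminormedRing A :=
    { ‹NonUnitalRing A›, ‹SeminormedAddCommGroup A› with norm_mul_le := hs.mul_le }
  let _ : NormedSpace ℂ A :=
    { ‹Module ℂ A› with norm_smul_le := fun c a => (map_smul_eq_mul s c a).le }
  have : NormedStarGroup A := ⟨fun a => (hs.star_eq a).le⟩
  exact exists_normPreserving_starHom_cstarAlgebra A fun x =>
    ((sq (s x)).symm.trans (hs.star_mul_self x).symm).le

end CStarSeminorm

/-! ### Primitive ideals of a locally C*-algebra. -/

section Primitive

theorem IsCStarSeminorm.zero {A : Type u} [NonUnitalRing A] [StarRing A] [Module ℂ A] :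
    IsCStarSeminorm (0 : Seminorm ℂ A) where
  mul_le _ _ := by simp
  star_eq _ := rfl
  star_mul_self _ := by simp

/-- Basic neighbourhoods are balls of finite suprema of seminorms; closure under `⊔` lets a single
C*-seminorm describe each of them. -/
theorem IsCStarSeminorm.sup {A : Type u} [NonUnitalRing A] [StarRing A] [Module ℂ A]
    {s t : Seminorm ℂ A} (hs : IsCStarSeminorm s) (ht : IsCStarSeminorm t) :
    IsCStarSeminorm (s ⊔ t) where
  mul_le a b := by
    simp only [Seminorm.sup_apply]
    exact max_le
      ((hs.mul_le a b).trans (mul_le_mul (le_max_left _ _) (le_max_left _ _) (apply_nonneg _ _)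
        ((apply_nonneg s a).trans (le_max_left _ _))))
      ((ht.mul_le a b).trans (mul_le_mul (le_max_right _ _) (le_max_right _ _) (apply_nonneg _ _)
        ((apply_nonneg s a).trans (le_max_left _ _))))
  star_eq a := by simp only [Seminorm.sup_apply, hs.star_eq, ht.star_eq]
  star_mul_self a := by
    simp only [Seminorm.sup_apply, hs.star_mul_self, ht.star_mul_self]
    rcases le_total (s a) (t a) with h | h
    · rw [max_eq_right h, max_eq_right (pow_le_pow_left₀ (apply_nonneg _ _) h 2)]
    · rw [max_eq_left h, max_eq_left (pow_le_pow_left₀ (apply_nonneg _ _) h 2)]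

variable {A : Type u} [NonUnitalRing A] [StarRing A] [Module ℂ A]

/-- Multiplication by `φ(A)` and by scalars preserves `φ(I)`; density of `ℂ1 + φ(A)` and closedness
extend this to all of `U`. -/
theorem isAlgebraIdeal_closure_map {U : Type u} [CStarAlgebra U] (φ : A →⋆ₙₐ[ℂ] U)
    (hd : DenseRange fun p : ℂ × A => p.1 • (1 : U) + φ p.2) {I : Submodule ℂ A}
    (hI : IsAlgebraIdeal I) :
    IsAlgebraIdeal (I.map (φ : A →ₗ[ℂ] U)).topologicalClosure := by
  set J := (I.map (φ : A →ₗ[ℂ] U)).topologicalClosure with hJ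
  have hJc : IsClosed (J : Set U) := Submodule.isClosed_topologicalClosure _
  have hmem : ∀ x ∈ I, φ x ∈ J := fun x hx =>
    Submodule.le_topologicalClosure _ (Submodule.mem_map_of_mem hx)
  have hext : ∀ f : U → U, Continuous f → (∀ x ∈ I, f (φ x) ∈ J) → ∀ y ∈ J, f y ∈ J := by
    intro f hf h y hy
    have hsub : closure (I.map (φ : A →ₗ[ℂ] U) : Set U) ⊆ f ⁻¹' J := by
      refine closure_minimal ?_ (hJc.preimage hf)
      rintro _ ⟨x, hx, rfl⟩
      exact h x hx
    exact hsub hy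
  constructor
  · intro u y hy
    refine hext (u * ·) (continuous_const_mul u) (fun x hx => ?_) y hy
    induction u using hd.induction_on with
    | hp => exact hJc.preimage (continuous_mul_const (φ x))
    | ih p =>
      rw [add_mul, smul_one_mul, ← map_mul]
      exact J.add_mem (J.smul_mem _ (hmem x hx)) (hmem _ (hI.mul_mem_left _ _ hx))
  · intro u y hy
    refine hext (· * u) (continuous_mul_const u) (fun x hx => ?_) y hy
    induction u using hd.induction_on with
    | hp => exact hJc.preimage (continuous_const_mul (φ x))
    | ih p =>
      rw [mul_add, mul_smul_one, ← map_mul]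
      exact J.add_mem (J.smul_mem _ (hmem x hx)) (hmem _ (hI.mul_mem_right _ _ hx))

variable [UniformSpace A]

theorem exists_continuous_cstarSeminorm_separating [LocallyCStarAlgebra A] {I : Submodule ℂ A}
    (hI : IsClosed (I : Set A)) {a : A} (ha : a ∉ I) :
    ∃ s : Seminorm ℂ A, IsCStarSeminorm s ∧ Continuous s ∧
      ∃ ε : ℝ, 0 < ε ∧ ∀ x ∈ I, ε ≤ s (x - a) := by
  obtain ⟨S, hS, hp⟩ := LocallyCStarAlgebra.exists_cstarSeminorms (A := A)
  obtain ⟨T, r, hr, hsub⟩ := (hp.mem_nhds_iff a (I : Set A)ᶜ).1 (hI.isOpen_compl.mem_nhds ha)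
  have hT : IsCStarSeminorm (T.sup fun s : S => (s : Seminorm ℂ A)) ∧
      Continuous ⇑(T.sup fun s : S => (s : Seminorm ℂ A)) := by
    classical
    clear hsub
    induction T using Finset.induction_on with
    | empty => exact ⟨IsCStarSeminorm.zero, continuous_const⟩
    | insert s T _ ih =>
      rw [Finset.sup_insert]
      exact ⟨(hS s s.2).sup ih.1, (hp.continuous_seminorm s).max ih.2⟩
  refine ⟨_, hT.1, hT.2, r, hr, fun x hx => ?_⟩
  by_contra! hlt
  exact hsub hlt hx

theorem ker_mem_primitiveSpectrum {H : Type u} [NormedAddCommGroup H] [InnerProductSpace ℂ H]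
    [CompleteSpace H] (ρ : A →⋆ₙₐ[ℂ] (H →L[ℂ] H)) (hc : Continuous ρ) (hρ : IsIrreducibleRep ρ) :
    LinearMap.ker (ρ : A →ₗ[ℂ] (H →L[ℂ] H)) ∈ PrimitiveSpectrum A := by
  refine ⟨⟨fun a x hx => ?_, fun a x hx => ?_⟩, H, inferInstance, inferInstance, inferInstance, ρ,
    hc, hρ, fun a => Iff.rfl⟩ <;>
  · have hx' : ρ x = 0 := hx
    change ρ _ = 0
    rw [map_mul, hx']
    simp

theorem exists_mem_primitiveSpectrum_notMem [LocallyCStarAlgebra A] {I : Submodule ℂ A}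
    (hI : IsAlgebraIdeal I) (hIc : IsClosed (I : Set A)) {a : A} (ha : a ∉ I) :
    ∃ P ∈ PrimitiveSpectrum A, I ≤ P ∧ a ∉ P := by
  obtain ⟨s, hs, hsc, ε, hε, hsep⟩ := exists_continuous_cstarSeminorm_separating hIc ha
  obtain ⟨U, _, φ, hφ, hd⟩ := hs.exists_cstarAlgebra
  let _ : PartialOrder U := CStarAlgebra.spectralOrder U
  have : StarOrderedRing U := CStarAlgebra.spectralOrderedRing U
  set J := (I.map (φ : A →ₗ[ℂ] U)).topologicalClosure with hJ
  have hJc : IsClosed (J : Set U) := Submodule.isClosed_topologicalClosure _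
  have haJ : φ a ∉ J := by
    intro hmem
    obtain ⟨_, ⟨x, hx, rfl⟩, hdist⟩ := Metric.mem_closure_iff.1 hmem ε hε
    refine (hsep x hx).not_gt ?_
    rw [dist_comm, dist_eq_norm] at hdist
    rw [← hφ, map_sub]
    exact hdist
  obtain ⟨H, _, _, _, π, hkill, hπa, hirr⟩ :=
    exists_irreducible_representation_of_notMem (isAlgebraIdeal_closure_map φ hd hI) hJc haJ
  let ρ : A →⋆ₙₐ[ℂ] (H →L[ℂ] H) := (π : U →⋆ₙₐ[ℂ] (H →L[ℂ] H)).comp φ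
  have hρ : ∀ x, ρ x = π (φ x) := fun _ => rfl
  have hπc : Continuous π := map_continuous π
  have hρc : Continuous ρ := by
    refine continuous_of_continuousAt_zero ρ ?_
    rw [ContinuousAt, map_zero]
    refine squeeze_zero_norm (fun x => ?_) ((hsc.tendsto 0).trans_eq ?_)
    · exact (NonUnitalStarAlgHom.norm_apply_le π (φ x)).trans_eq (hφ x)
    · rw [map_zero]
  -- A closed subspace invariant under `φ(A)` is invariant under the dense `ℂ1 + φ(A)`, hence under
  -- `U`, so irreducibility passes from `π` to `ρ`.
  refine ⟨_, ker_mem_primitiveSpectrum ρ hρc ⟨⟨a, hπa⟩, fun V hVc hV => ?_⟩, fun x hx => ?_, hπa⟩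
  · refine hirr V hVc fun u v hv => ?_
    induction u using hd.induction_on with
    | hp =>
      exact hVc.preimage ((ContinuousLinearMap.apply ℂ H v).continuous.comp hπc)
    | ih p =>
      rw [map_add, map_smul, map_one]
      exact V.add_mem (V.smul_mem _ hv) (hV p.2 v hv)
  · exact hkill _ (Submodule.le_topologicalClosure _ (Submodule.mem_map_of_mem hx))

theorem le_or_le_of_inf_le_of_mem_primitiveSpectrum {P : Submodule ℂ A}
    (hP : P ∈ PrimitiveSpectrum A) {I J : Submodule ℂ A} (hI : IsAlgebraIdeal I)
    (hJ : IsAlgebraIdeal J) (hIJ : I ⊓ J ≤ P) : I ≤ P ∨ J ≤ P := by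
  obtain ⟨-, H, _, _, _, π, -, hirr, hker⟩ := hP
  by_contra! hcon
  obtain ⟨hIP, hJP⟩ := hcon
  obtain ⟨i, hi, hiP⟩ := Set.not_subset.1 hIP
  obtain ⟨j, hj, hjP⟩ := Set.not_subset.1 hJP
  have hij : ∀ x ∈ J, π i * π x = 0 := fun x hx => by
    rw [← map_mul, ← hker]
    exact hIJ ⟨hI.mul_mem_right _ _ hi, hJ.mul_mem_left _ _ hx⟩
  -- The closed span of `π(J)H` is invariant because `J` is a left ideal. If it is `0`, then `π j =
  -- 0`; if it is `H`, then `π i = 0`, since `π i` kills `π(J)H`.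
  set V : Submodule ℂ H :=
    (Submodule.span ℂ {w | ∃ x ∈ J, ∃ v : H, π x v = w}).topologicalClosure with hV
  have hVc : IsClosed (V : Set H) := Submodule.isClosed_topologicalClosure _
  have hmem : ∀ x ∈ J, ∀ v, π x v ∈ V := fun x hx v =>
    Submodule.le_topologicalClosure _ (Submodule.subset_span ⟨x, hx, v, rfl⟩)
  have hle : ∀ (T : H →L[ℂ] H) (W : Submodule ℂ H), IsClosed (W : Set H) →
      (∀ x ∈ J, ∀ v, T (π x v) ∈ W) → ∀ v ∈ V, T v ∈ W := by
    intro T W hW h v hv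
    have hVW : V ≤ W.comap (T : H →ₗ[ℂ] H) := by
      refine Submodule.topologicalClosure_minimal _ (Submodule.span_le.2 ?_)
        (hW.preimage T.continuous)
      rintro _ ⟨x, hx, v, rfl⟩
      exact h x hx v
    exact hVW hv
  have hinv : ∀ a, ∀ v ∈ V, π a v ∈ V := fun a => hle (π a) V hVc fun x hx v => by
    rw [← mul_apply_eq_comp, ← map_mul]
    exact hmem _ (hJ.mul_mem_left _ _ hx) v
  rcases hirr.eq_bot_or_eq_top V hVc hinv with h | h
  · refine hjP ((hker j).2 (ContinuousLinearMap.ext fun v => ?_))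
    simpa [h] using hmem j hj v
  · refine hiP ((hker i).2 (ContinuousLinearMap.ext fun v => ?_))
    have := hle (π i) ⊥ (by simp) (fun x hx v => by
      rw [← mul_apply_eq_comp, hij x hx]
      simp) v (by rw [h]; trivial)
    simpa using this

end Primitive

theorem mainTheorem8 (A : Type u) [NonUnitalRing A] [StarRing A] [Module ℂ A]
    [UniformSpace A] [LocallyCStarAlgebra A] :
    (∀ I : Submodule ℂ A, IsAlgebraIdeal I → IsClosed (I : Set A) →
      (I : Set A) = ⋂ P ∈ {P : Submodule ℂ A | P ∈ PrimitiveSpectrum A ∧ I ≤ P}, (P : Set A)) ∧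
    (∀ P ∈ PrimitiveSpectrum A, ∀ I J : Submodule ℂ A, IsAlgebraIdeal I → IsAlgebraIdeal J →
      I ⊓ J ≤ P → I ≤ P ∨ J ≤ P) := by
  refine ⟨fun I hI hIc => ?_, fun P hP I J hI hJ h =>
    le_or_le_of_inf_le_of_mem_primitiveSpectrum hP hI hJ h⟩
  refine Set.Subset.antisymm (Set.subset_iInter₂ fun P hP => hP.2) fun a ha => ?_
  by_contra haI
  obtain ⟨P, hP, hIP, haP⟩ := exists_mem_primitiveSpectrum_notMem hI hIc haI
  exact haP (Set.mem_iInter₂.1 ha P ⟨hP, hIP⟩)
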